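/- Let $\mathcal H$ be a complex Hilbert space. For a contraction $T$ on $\mathcal H$ let $S_T$ be its asymptotic limit, i.e. the strong limit of $T^{*n}T^n$ as $n\to\infty$. A contraction $T$ is of class $C_{0\cdot}$ if $T^nh\to0$ for every $h$, and of class $C_{1\cdot}$ if $T^nh\not\to0$ for every $h\neq0$. We say that $T$ is Harnack dominated by $T'$, written $T\prec_H T'$, if there is a constant $c\ge1$ such that $\operatorname{Re}p(T)\le c\operatorname{Re}p(T')$ for every complex polynomial $p$ with $\operatorname{Re}p(z)\ge0$ for $|z|\le1$; $T$ and $T'$ are Harnack equivalent if $T\prec_H T'$ and $T'\prec_H T$. The canonical triangulation of $T$ is its matrix with respect to the orthogonal decomposition $\mathcal H=\mathcal N(S_T)\oplus\overline{\mathcal R(S_T)}$ into the null space and the closure of the range of $S_T$. **Theorem.** Let $T$ and $T'$ be commuting contractions on $\mathcal H$ such that $T\prec_H T'$. Then $\mathcal N(S_T)=\mathcal N(S_{T'})$, $\overline{\mathcal R(S_T)}=\overline{\mathcal R(S_{T'})}$, and the canonical triangulations of $T$ and $T'$ have the form $$T=\begin{pmatrix}Q&R\\0&W\end{pmatrix},\qquad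 T'=\begin{pmatrix}Q'&R'\\0&W\end{pmatrix},$$ where $Q,Q'$ are contractions of class $C_{0\cdot}$ on $\mathcal N(S_T)=\mathcal N(S_{T'})$ with $QQ'=Q'Q$ and $Q\prec_H Q'$, and $W$ is a contraction of class $C_{1\cdot}$ on $\overline{\mathcal R(S_T)}$ such that $QR'-Q'R=(R'-R)W$. Moreover, $S_T=S_T^2$ if and only if $S_{T'}=S_{T'}^2$. In this case $S_T=S_{T'}$, $W$ is an isometry and $R=R'=0$; in addition, $T$ and $T'$ are Harnack equivalent if and only if $Q'\prec_H Q$. -/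

import Mathlib

open Filter Topology ComplexStarModule

noncomputable section

variable {H : Type*} [NormedAddCommGroup H] [InnerProductSpace ℂ H]

/-- For a contraction `T`, the operators `T*ⁿ Tⁿ` converge strongly. -/
theorem exists_asymptoticLimit [CompleteSpace H] (T : H →L[ℂ] H) (hT : ‖T‖ ≤ 1) :
    ∃ S : H →L[ℂ] H,
      ∀ x, Tendsto (fun n : ℕ => (ContinuousLinearMap.adjoint T ^ n * T ^ n) x) atTop (𝓝 (S x)) := by
  have hpow : ∀ n : ℕ, ContinuousLinearMap.adjoint T ^ n = ContinuousLinearMap.adjoint (T ^ n) := by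
    intro n
    rw [← ContinuousLinearMap.star_eq_adjoint, ← ContinuousLinearMap.star_eq_adjoint, star_pow]
  have hcontr : ∀ n : ℕ, ‖T ^ n‖ ≤ 1 := fun n => by
    rcases Nat.eq_zero_or_pos n with rfl | hn
    · exact ContinuousLinearMap.norm_id_le
    · exact (norm_pow_le' T hn).trans (pow_le_one₀ (norm_nonneg _) hT)
  have hle : ∀ (n : ℕ) (x : H), ‖(T ^ n) x‖ ≤ ‖x‖ := fun n x => by
    simpa using (T ^ n).le_of_opNorm_le (hcontr n) x
  have hadj : ∀ (n : ℕ) (x : H), ‖ContinuousLinearMap.adjoint (T ^ n) x‖ ≤ ‖x‖ := fun n x => by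
    have h := (ContinuousLinearMap.adjoint (T ^ n)).le_of_opNorm_le
      (c := 1) (by simpa using hcontr n) x
    simpa using h
  set A : ℕ → H →L[ℂ] H := fun n => ContinuousLinearMap.adjoint T ^ n * T ^ n with hA
  have hAle : ∀ (n : ℕ) (x : H), ‖A n x‖ ≤ ‖x‖ := fun n x => by
    simp only [hA, hpow]
    exact (hadj n _).trans (hle n x)
  have hAinner : ∀ (n : ℕ) (x y : H), inner ℂ (A n x) y = inner ℂ ((T ^ n) x) ((T ^ n) y) := by
    intro n x y
    simp only [hA, hpow]
    exact ContinuousLinearMap.adjoint_inner_left (T ^ n) y ((T ^ n) x)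
  have hanti : ∀ x : H, Antitone fun n : ℕ => ‖(T ^ n) x‖ ^ 2 := fun x =>
    antitone_nat_of_succ_le fun n => by
      have h : (T ^ (n + 1)) x = T ((T ^ n) x) := by rw [pow_succ']; rfl
      have := T.le_of_opNorm_le hT ((T ^ n) x)
      rw [h]
      gcongr
      simpa using this
  have key : ∀ (m k : ℕ) (x : H), ‖A m x - A (m + k) x‖ ^ 2 ≤
      ‖(T ^ m) x‖ ^ 2 - ‖(T ^ (m + k)) x‖ ^ 2 := by
    intro m k x
    have e1 : A m x - A (m + k) x =
        ContinuousLinearMap.adjoint (T ^ m) ((T ^ m) x - A k ((T ^ m) x)) := by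
      have : A (m + k) x = ContinuousLinearMap.adjoint (T ^ m) (A k ((T ^ m) x)) := by
        rw [← hpow]
        simp only [hA]
        rw [pow_add (ContinuousLinearMap.adjoint T), add_comm m k, pow_add T]
        rfl
      rw [this, map_sub]
      simp only [hA, hpow]
      rfl
    have e2 : (T ^ (m + k)) x = (T ^ k) ((T ^ m) x) := by
      rw [add_comm, pow_add]; rfl
    rw [e1, e2]
    set y := (T ^ m) x
    have h1 := hadj m (y - A k y)
    have h2 : ‖y - A k y‖ ^ 2 = ‖y‖ ^ 2 - 2 * ‖(T ^ k) y‖ ^ 2 + ‖A k y‖ ^ 2 := by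
      rw [@norm_sub_sq ℂ, ← inner_conj_symm, hAinner, inner_self_eq_norm_sq_to_K]
      congr 2
      norm_cast
    have h3 : ‖A k y‖ ≤ ‖(T ^ k) y‖ := by
      simp only [hA, hpow]
      exact hadj k _
    have h4 : ‖A k y‖ ^ 2 ≤ ‖(T ^ k) y‖ ^ 2 := by gcongr
    calc _ ≤ ‖y - A k y‖ ^ 2 := by gcongr
      _ ≤ _ := by rw [h2]; linarith
  have hcau : ∀ x, CauchySeq fun n => A n x := by
    intro x
    have hconv : CauchySeq fun n : ℕ => ‖(T ^ n) x‖ ^ 2 :=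
      (tendsto_atTop_ciInf (hanti x) ⟨0, by rintro _ ⟨n, rfl⟩; positivity⟩).cauchySeq
    rw [Metric.cauchySeq_iff'] at hconv ⊢
    intro ε hε
    obtain ⟨N, hN⟩ := hconv (ε ^ 2) (by positivity)
    refine ⟨N, fun n hn => ?_⟩
    obtain ⟨k, rfl⟩ := Nat.exists_eq_add_of_le hn
    have h := hN _ hn
    rw [dist_comm, Real.dist_eq] at h
    rw [dist_comm, dist_eq_norm]
    exact lt_of_pow_lt_pow_left₀ 2 hε.le
      ((key N k x).trans_lt ((le_abs_self _).trans_lt h))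
  choose f hf using fun x => cauchySeq_tendsto_of_complete (hcau x)
  refine ⟨LinearMap.mkContinuous
    { toFun := f
      map_add' := fun x y => tendsto_nhds_unique (hf (x + y))
        (by simpa only [map_add] using (hf x).add (hf y))
      map_smul' := fun c x => tendsto_nhds_unique (hf (c • x))
        (by simpa only [map_smul, RingHom.id_apply] using (hf x).const_smul c) } 1 ?_, hf⟩
  intro x
  simpa using le_of_tendsto (hf x).norm (Eventually.of_forall fun n => hAle n x)

open Classical in
/-- The asymptotic limit `S_T`: the strong limit of `T*ⁿ Tⁿ`, which exists for every
contraction `T` (the value `0` is used when there is no strong limit). -/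
def asymptoticLimit [CompleteSpace H] (T : H →L[ℂ] H) : H →L[ℂ] H :=
  if h : ∃ S : H →L[ℂ] H, ∀ x,
      Tendsto (fun n : ℕ => (ContinuousLinearMap.adjoint T ^ n * T ^ n) x) atTop (𝓝 (S x))
  then h.choose else 0

/-- The defining property of the asymptotic limit of a contraction. -/
theorem tendsto_asymptoticLimit [CompleteSpace H] (T : H →L[ℂ] H) (hT : ‖T‖ ≤ 1) (x : H) :
    Tendsto (fun n : ℕ => (ContinuousLinearMap.adjoint T ^ n * T ^ n) x) atTop
      (𝓝 (asymptoticLimit T x)) := by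
  have h := exists_asymptoticLimit T hT
  rw [asymptoticLimit, dif_pos h]
  exact h.choose_spec x

/-- The null space `N(S_T)` of the asymptotic limit. -/
abbrev nullSpaceAL [CompleteSpace H] (T : H →L[ℂ] H) : Submodule ℂ H :=
  (asymptoticLimit T).ker

/-- The closure of the range of the asymptotic limit `S_T`. -/
abbrev closedRangeAL [CompleteSpace H] (T : H →L[ℂ] H) : Submodule ℂ H :=
  (asymptoticLimit T).range.topologicalClosure

/-- `T` is a contraction of class `C_{0·}`: `Tⁿ x → 0` for every `x`. -/
def IsClassC0 (T : H →L[ℂ] H) : Prop :=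
  ‖T‖ ≤ 1 ∧ ∀ x, Tendsto (fun n : ℕ => (T ^ n) x) atTop (𝓝 0)

/-- `T` is a contraction of class `C_{1·}`: `Tⁿ x` does not tend to `0`, for every `x ≠ 0`. -/
def IsClassC1 (T : H →L[ℂ] H) : Prop :=
  ‖T‖ ≤ 1 ∧ ∀ x, x ≠ 0 → ¬ Tendsto (fun n : ℕ => (T ^ n) x) atTop (𝓝 0)

/-- `T` is Harnack dominated by `T'`: there is `c ≥ 1` with `Re p(T) ≤ c Re p(T')` (in the order
of self-adjoint operators) for every polynomial `p` with `Re p ≥ 0` on the closed unit disc. -/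
def HarnackDominated [CompleteSpace H] (T T' : H →L[ℂ] H) : Prop :=
  ∃ c : ℝ, 1 ≤ c ∧ ∀ p : Polynomial ℂ, (∀ z : ℂ, ‖z‖ ≤ 1 → 0 ≤ (p.eval z).re) →
    (ℜ (Polynomial.aeval T p) : H →L[ℂ] H) ≤ c • (ℜ (Polynomial.aeval T' p) : H →L[ℂ] H)

/-- Harnack equivalence: Harnack domination in both directions. -/
def HarnackEquivalent [CompleteSpace H] (T T' : H →L[ℂ] H) : Prop :=
  HarnackDominated T T' ∧ HarnackDominated T' T

/-- `T` has canonical triangulation `(Q R; 0 W)`, the blocks being taken with respect to the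
orthogonal decomposition `H = M ⊕ L`, where `M = N(S_T)` and `L` is the closure of the range
of `S_T`. -/
structure IsCanonicalTriangulation [CompleteSpace H] (T : H →L[ℂ] H) {M L : Submodule ℂ H}
    (Q : M →L[ℂ] M) (R : L →L[ℂ] M) (W : L →L[ℂ] L) : Prop where
  null_eq : M = nullSpaceAL T
  range_eq : L = closedRangeAL T
  ortho : M ⟂ L
  compl : IsCompl M L
  apply_add : ∀ (x : M) (y : L), T ((x : H) + (y : H)) = ((Q x + R y : M) : H) + ((W y : L) : H)

end

/-!
Testing Harnack domination on the polynomials whose real parts on the circle are Fejér kernels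
turns it into a quadratic inequality between the resolvents of the two operators. Domination passes
to the truncated backward shifts with operator weights `T` and `T'`, by averaging over roots of
unity, and there that inequality reads
`‖∑ₙ Tⁿ (T - T') gₙ‖² ≤ c ∑ₙ (‖gₙ‖² - ‖T' gₙ‖²)`.
One term shows `T'ⁿ (T - T') x → 0`; for commuting operators, the choice `gₖ = Tⁿ⁻ᵏ x` makes all
the terms on the left equal and shows `Tⁿ (T - T') x → 0`. So `T - T'` maps into both null spaces.
The form `⟨S_T x, x⟩ = lim ‖Tⁿ x‖²` is `T`-invariant and only depends on `x` modulo `N(S_T)`, so it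
is `T'`-invariant as well; being bounded by `‖x‖²`, it is bounded by `⟨S_{T'} x, x⟩`. By symmetry
`S_T = S_{T'}`, and the lower right blocks agree. If `S_T` is idempotent, it is the projection onto
its range, which then reduces both `T` and `T'` to the same operator `W`.
-/

section Contraction

variable {𝕜 E F : Type*} [NontriviallyNormedField 𝕜] [SeminormedAddCommGroup E] [NormedSpace 𝕜 E]
  [SeminormedAddCommGroup F] [NormedSpace 𝕜 F]

theorem norm_apply_le_of_norm_le_one {T : E →L[𝕜] F} (hT : ‖T‖ ≤ 1) (x : E) : ‖T x‖ ≤ ‖x‖ := by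
  simpa only [one_mul] using T.le_of_opNorm_le hT x

theorem norm_pow_apply_le_of_norm_le_one {T : E →L[𝕜] E} (hT : ‖T‖ ≤ 1) (n : ℕ) (x : E) :
    ‖(T ^ n) x‖ ≤ ‖x‖ := by
  induction n with
  | zero => exact le_rfl
  | succ n ih =>
    rw [pow_succ', mul_apply_eq_comp]
    exact (norm_apply_le_of_norm_le_one hT _).trans ih

end Contraction

section Semiconj

variable {R E F G : Type*} [TopologicalSpace E] [TopologicalSpace F] [FunLike G E F]

theorem map_pow_apply_of_semiconj [Semiring R] [AddCommMonoid E] [AddCommMonoid F] [Module R E]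
    [Module R F] {X : G} {A : E →L[R] E} {B : F →L[R] F} (h : ∀ x, X (A x) = B (X x)) (n : ℕ)
    (x : E) : X ((A ^ n) x) = (B ^ n) (X x) := by
  simp only [FunLike.coe_pow_eq_iterate]
  exact (Function.Semiconj.iterate_right h n).eq x

theorem map_aeval_apply_of_semiconj [CommRing R] [AddCommGroup E] [AddCommGroup F]
    [IsTopologicalAddGroup E] [IsTopologicalAddGroup F] [Module R E] [Module R F]
    [ContinuousConstSMul R E] [ContinuousConstSMul R F] [LinearMapClass G R E F] {X : G}
    {A : E →L[R] E} {B : F →L[R] F} (h : ∀ x, X (A x) = B (X x)) (p : Polynomial R) (x : E) :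
    X (Polynomial.aeval A p x) = Polynomial.aeval B p (X x) := by
  simp only [Polynomial.aeval_eq_sum_range, sum_apply, smul_apply, map_sum, map_smul,
    map_pow_apply_of_semiconj h]

end Semiconj

section FejerPolynomial

open Polynomial

/-- The polynomial `∑_{m < M} (2 ∑_{n ≤ m} Xⁿ - 1)`, whose real part on the unit circle is `M` times
the Fejér kernel; it tests Harnack domination on Cesàro means of the partial sums of `∑ Tⁿ`. -/
noncomputable def fejerPolynomial (M : ℕ) : ℂ[X] :=
  ∑ m ∈ Finset.range M, (2 * ∑ n ∈ Finset.range (m + 1), X ^ n - 1)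

theorem aeval_fejerPolynomial {A : Type*} [Ring A] [Algebra ℂ A] (a : A) (M : ℕ) :
    aeval a (fejerPolynomial M) =
      ∑ m ∈ Finset.range M, (2 * ∑ n ∈ Finset.range (m + 1), a ^ n - 1) := by
  simp only [fejerPolynomial, map_sum, map_sub, map_mul, map_pow, aeval_X, map_one, map_ofNat]

theorem sq_norm_geom_sum_le_re_eval_fejerPolynomial {z : ℂ} (hz : ‖z‖ ≤ 1) (M : ℕ) :
    ‖∑ n ∈ Finset.range M, z ^ n‖ ^ 2 ≤ ((fejerPolynomial M).eval z).re := by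
  rw [← coe_aeval_eq_eval, aeval_fejerPolynomial]
  induction M with
  | zero => simp
  | succ M ih =>
    rw [Finset.sum_range_succ (fun m => _ - _), geom_sum_succ, Complex.add_re]
    set σ := ∑ n ∈ Finset.range M, z ^ n
    have norm_mul_le : ‖z * σ‖ ^ 2 ≤ ‖σ‖ ^ 2 := by
      rw [norm_mul]
      gcongr
      exact mul_le_of_le_one_left (norm_nonneg _) hz
    have norm_add_one : ‖z * σ + 1‖ ^ 2 = ‖z * σ‖ ^ 2 + (2 * (z * σ + 1) - 1).re := by
      simp only [← Complex.normSq_eq_norm_sq, Complex.normSq_add, map_one, mul_one,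
        Complex.add_re, Complex.sub_re, Complex.mul_re, Complex.one_re, Complex.re_ofNat,
        Complex.im_ofNat]
      ring
    linarith

theorem re_eval_fejerPolynomial_nonneg {z : ℂ} (hz : ‖z‖ ≤ 1) (M : ℕ) :
    0 ≤ ((fejerPolynomial M).eval z).re :=
  (sq_nonneg _).trans (sq_norm_geom_sum_le_re_eval_fejerPolynomial hz M)

end FejerPolynomial

/-- Harnack domination `T ≺_H T'` with the constant `c`. It is expressed through quadratic forms, so
that it makes sense without completeness of the space, as is convenient for amplifications. -/
def HarnackDominatedWith {E : Type*} [NormedAddCommGroup E] [InnerProductSpace ℂ E]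
    (c : ℝ) (T T' : E →L[ℂ] E) : Prop :=
  ∀ p : Polynomial ℂ, (∀ z : ℂ, ‖z‖ ≤ 1 → 0 ≤ (p.eval z).re) → ∀ x,
    (inner ℂ x (Polynomial.aeval T p x)).re ≤ c * (inner ℂ x (Polynomial.aeval T' p x)).re

section HarnackDominatedWith

variable {E F : Type*} [NormedAddCommGroup E] [InnerProductSpace ℂ E]
  [NormedAddCommGroup F] [InnerProductSpace ℂ F]

theorem inner_realPart_apply [CompleteSpace E] (A : E →L[ℂ] E) (x : E) :
    inner ℂ x ((ℜ A : E →L[ℂ] E) x) = ((inner ℂ x (A x)).re : ℂ) := by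
  have inner_star : inner ℂ x ((star A) x) = (starRingEnd ℂ) (inner ℂ x (A x)) := by
    rw [ContinuousLinearMap.star_eq_adjoint, ContinuousLinearMap.adjoint_inner_right,
      inner_conj_symm]
  rw [realPart_apply_coe, smul_apply, add_apply, inner_smul_right_eq_smul, inner_add_right,
    inner_star, Complex.add_conj]
  simp

theorem realPart_le_smul_realPart_iff [CompleteSpace E] {A B : E →L[ℂ] E} {c : ℝ} :
    (ℜ A : E →L[ℂ] E) ≤ c • (ℜ B : E →L[ℂ] E) ↔
      ∀ x, (inner ℂ x (A x)).re ≤ c * (inner ℂ x (B x)).re := by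
  rw [ContinuousLinearMap.le_def, ContinuousLinearMap.isPositive_iff_complex]
  refine forall_congr' fun x => ?_
  have inner_sub_apply : inner ℂ ((c • (ℜ B : E →L[ℂ] E) - (ℜ A : E →L[ℂ] E)) x) x =
      ((c * (inner ℂ x (B x)).re - (inner ℂ x (A x)).re : ℝ) : ℂ) := by
    rw [← inner_conj_symm, sub_apply, smul_apply, inner_sub_right, inner_smul_right_eq_smul,
      inner_realPart_apply, inner_realPart_apply]
    simp
  rw [inner_sub_apply]
  simp

theorem harnackDominated_iff [CompleteSpace E] {T T' : E →L[ℂ] E} :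
    HarnackDominated T T' ↔ ∃ c : ℝ, 1 ≤ c ∧ HarnackDominatedWith c T T' := by
  simp only [HarnackDominated, HarnackDominatedWith, realPart_le_smul_realPart_iff]

namespace HarnackDominatedWith

theorem smul {c : ℝ} {T T' : E →L[ℂ] E} (h : HarnackDominatedWith c T T') {w : ℂ} (hw : ‖w‖ ≤ 1) :
    HarnackDominatedWith c (w • T) (w • T') := by
  intro p hp x
  have aeval_rotate (A : E →L[ℂ] E) :
      Polynomial.aeval A (p.comp (Polynomial.C w * Polynomial.X)) = Polynomial.aeval (w • A) p := by
    rw [Polynomial.aeval_comp, map_mul, Polynomial.aeval_C, Polynomial.aeval_X,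
      ← Algebra.smul_def]
  rw [← aeval_rotate, ← aeval_rotate]
  refine h _ (fun z hz => ?_) x
  rw [Polynomial.eval_comp, Polynomial.eval_C_mul, Polynomial.eval_X]
  exact hp _ (by rw [norm_mul]; exact mul_le_one₀ hw (norm_nonneg z) hz)

theorem of_semiconj {c : ℝ} {A A' : E →L[ℂ] E} {T T' : F →L[ℂ] F} (J : E →ₗᵢ[ℂ] F)
    (hA : ∀ x, J (A x) = T (J x)) (hA' : ∀ x, J (A' x) = T' (J x))
    (h : HarnackDominatedWith c T T') : HarnackDominatedWith c A A' := by
  intro p hp x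
  rw [← J.inner_map_map, ← J.inner_map_map, map_aeval_apply_of_semiconj hA,
    map_aeval_apply_of_semiconj hA']
  exact h p hp (J x)

end HarnackDominatedWith

end HarnackDominatedWith

section Resolvent

variable {E : Type*} [NormedAddCommGroup E] [InnerProductSpace ℂ E]

theorem geom_sum_apply_sub_apply {R E : Type*} [Ring R] [AddCommGroup E] [TopologicalSpace E]
    [IsTopologicalAddGroup E] [Module R E] (A : E →L[R] E) (s : E) (m : ℕ) :
    (∑ n ∈ Finset.range m, A ^ n) (s - A s) = s - (A ^ m) s := by
  simpa using congr($(geom_sum_mul_neg A m) s)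

theorem re_inner_sub_apply_add_apply (A : E →L[ℂ] E) (s : E) :
    (inner ℂ (s - A s) (s + A s)).re = ‖s‖ ^ 2 - ‖A s‖ ^ 2 := by
  have inner_self_re (x : E) : (inner ℂ x x).re = ‖x‖ ^ 2 := inner_self_eq_norm_sq (𝕜 := ℂ) x
  have inner_comm_re : (inner ℂ (A s) s).re = (inner ℂ s (A s)).re :=
    inner_re_symm (𝕜 := ℂ) (A s) s
  rw [inner_sub_left, inner_add_right, inner_add_right]
  simp only [Complex.sub_re, Complex.add_re, inner_self_re, inner_comm_re]
  ring

theorem tendsto_inner_aeval_fejerPolynomial {A : E →L[ℂ] E} {s : E}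
    (hs : Tendsto (fun n : ℕ => (A ^ n) s) atTop (𝓝 0)) :
    Tendsto (fun M : ℕ => (M : ℝ)⁻¹ *
      (inner ℂ (s - A s) (Polynomial.aeval A (fejerPolynomial M) (s - A s))).re) atTop
      (𝓝 (‖s‖ ^ 2 - ‖A s‖ ^ 2)) := by
  have dirichlet_apply (m : ℕ) :
      (2 * ∑ n ∈ Finset.range (m + 1), A ^ n - 1 : E →L[ℂ] E) (s - A s) =
        s + A s - (2 : ℂ) • (A ^ (m + 1)) s := by
    rw [sub_apply, two_mul, add_apply, geom_sum_apply_sub_apply, one_apply_eq_self, two_smul]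
    abel
  have tendsto_dirichlet : Tendsto (fun m : ℕ => (inner ℂ (s - A s)
      ((2 * ∑ n ∈ Finset.range (m + 1), A ^ n - 1 : E →L[ℂ] E) (s - A s))).re) atTop
      (𝓝 (‖s‖ ^ 2 - ‖A s‖ ^ 2)) := by
    simp only [dirichlet_apply, ← re_inner_sub_apply_add_apply]
    have tail := ((tendsto_add_atTop_iff_nat 1).2 hs).const_smul (2 : ℂ)
    rw [smul_zero] at tail
    simpa only [sub_zero, Function.comp_def] using Complex.continuous_re.continuousAt.tendsto.comp
      ((tendsto_const_nhds (x := s - A s)).inner (𝕜 := ℂ)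
        ((tendsto_const_nhds (x := s + A s)).sub tail))
  simpa only [aeval_fejerPolynomial, sum_apply, inner_sum, Complex.re_sum] using
    tendsto_dirichlet.cesaro

theorem HarnackDominatedWith.sq_norm_sub_sq_norm_apply_le {c : ℝ} {A A' : E →L[ℂ] E}
    (h : HarnackDominatedWith c A A') {s f : E} (hsf : s - A s = f - A' f)
    (hs : Tendsto (fun n : ℕ => (A ^ n) s) atTop (𝓝 0))
    (hf : Tendsto (fun n : ℕ => (A' ^ n) f) atTop (𝓝 0)) :
    ‖s‖ ^ 2 - ‖A s‖ ^ 2 ≤ c * (‖f‖ ^ 2 - ‖A' f‖ ^ 2) := by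
  refine le_of_tendsto_of_tendsto' (tendsto_inner_aeval_fejerPolynomial hs)
    ((tendsto_inner_aeval_fejerPolynomial hf).const_mul c) fun M => ?_
  rw [hsf, mul_left_comm]
  exact mul_le_mul_of_nonneg_left
    (h _ (fun z hz => re_eval_fejerPolynomial_nonneg hz M) _) (by positivity)

end Resolvent

section BackwardShift

/-- The operator `(h₀, …, h_N) ↦ (T h₁, …, T h_N, 0)` on the Hilbert sum of `N + 1` copies of `E`:
the nilpotent amplification of `T` by the backward shift. -/
noncomputable def backwardShift {E : Type*} [NormedAddCommGroup E] [InnerProductSpace ℂ E]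
    (T : E →L[ℂ] E) (N : ℕ) :
    PiLp 2 (fun _ : Fin (N + 1) => E) →L[ℂ] PiLp 2 (fun _ : Fin (N + 1) => E) :=
  (PiLp.continuousLinearEquiv 2 ℂ fun _ : Fin (N + 1) => E).symm.toContinuousLinearMap ∘L
    ContinuousLinearMap.pi
      (Fin.snoc (fun i => T ∘L PiLp.proj 2 (fun _ : Fin (N + 1) => E) i.succ) 0)

variable {E : Type*} [NormedAddCommGroup E] [InnerProductSpace ℂ E] {N : ℕ}

@[simp]
theorem backwardShift_castSucc (T : E →L[ℂ] E) (h : PiLp 2 fun _ : Fin (N + 1) => E) (i : Fin N) :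
    backwardShift T N h i.castSucc = T (h i.succ) := by
  simp [backwardShift]

@[simp]
theorem backwardShift_last (T : E →L[ℂ] E) (h : PiLp 2 fun _ : Fin (N + 1) => E) :
    backwardShift T N h (Fin.last N) = 0 := by
  simp [backwardShift]

theorem pow_backwardShift_apply (T : E →L[ℂ] E) (h : PiLp 2 fun _ : Fin (N + 1) => E) {n : ℕ}
    {i j : Fin (N + 1)} (hij : i + n = (j : ℕ)) :
    (backwardShift T N ^ n) h i = (T ^ n) (h j) := by
  induction n generalizing h j with
  | zero => rw [Fin.ext hij]; rfl
  | succ n ih =>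
    obtain ⟨k, rfl⟩ := Fin.exists_succ_eq.2 (show j ≠ 0 by rw [Fin.ne_iff_vne, ← hij]; simp)
    rw [Fin.val_succ, ← add_assoc, add_left_inj] at hij
    rw [pow_succ, mul_apply_eq_comp, ih (j := k.castSucc) _ hij, backwardShift_castSucc, pow_succ,
      mul_apply_eq_comp]

theorem pow_backwardShift_apply_eq_zero (T : E →L[ℂ] E) (h : PiLp 2 fun _ : Fin (N + 1) => E)
    {n : ℕ} {i : Fin (N + 1)} (hi : N < i + n) : (backwardShift T N ^ n) h i = 0 := by
  induction n generalizing i with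
  | zero => omega
  | succ n ih =>
    rw [pow_succ', mul_apply_eq_comp]
    induction i using Fin.lastCases with
    | last => exact backwardShift_last T _
    | cast i =>
      rw [Fin.val_castSucc] at hi
      rw [backwardShift_castSucc, ih (by rw [Fin.val_succ]; omega), map_zero]

theorem pow_backwardShift_eq_zero (T : E →L[ℂ] E) {n : ℕ} (hn : N < n) :
    backwardShift T N ^ n = 0 := by
  ext h i
  exact pow_backwardShift_apply_eq_zero T h (by omega)

theorem tendsto_pow_backwardShift_apply (T : E →L[ℂ] E) (h : PiLp 2 fun _ : Fin (N + 1) => E) :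
    Tendsto (fun n : ℕ => (backwardShift T N ^ n) h) atTop (𝓝 0) := by
  refine tendsto_const_nhds.congr' ?_
  filter_upwards [eventually_gt_atTop N] with n hn
  rw [pow_backwardShift_eq_zero T hn, zero_apply]

theorem sq_norm_sub_sq_norm_backwardShift (T : E →L[ℂ] E) (h : PiLp 2 fun _ : Fin (N + 1) => E) :
    ‖h‖ ^ 2 - ‖backwardShift T N h‖ ^ 2 =
      ‖h 0‖ ^ 2 + ∑ i : Fin N, (‖h i.succ‖ ^ 2 - ‖T (h i.succ)‖ ^ 2) := by
  rw [PiLp.norm_sq_eq_of_L2, PiLp.norm_sq_eq_of_L2, Fin.sum_univ_succ, Fin.sum_univ_castSucc,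
    Finset.sum_sub_distrib]
  simp only [backwardShift_castSucc, backwardShift_last, norm_zero, ne_eq, OfNat.ofNat_ne_zero,
    not_false_eq_true, zero_pow, add_zero]
  ring

theorem sq_norm_apply_zero_le {T : E →L[ℂ] E} (hT : ‖T‖ ≤ 1)
    (h : PiLp 2 fun _ : Fin (N + 1) => E) :
    ‖h 0‖ ^ 2 ≤ ‖h‖ ^ 2 - ‖backwardShift T N h‖ ^ 2 := by
  rw [sq_norm_sub_sq_norm_backwardShift]
  refine le_add_of_nonneg_right (Finset.sum_nonneg fun i _ => sub_nonneg.2 ?_)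
  gcongr
  exact norm_apply_le_of_norm_le_one hT _

end BackwardShift

section Amplification

open ComplexConjugate

theorem sum_pow_mul_conj_pow {ζ : ℂ} {K : ℕ} (hζ : IsPrimitiveRoot ζ K) {i j : ℕ}
    (hi : i < K) (hj : j < K) :
    ∑ k ∈ Finset.range K, (ζ ^ k) ^ i * conj (ζ ^ k) ^ j = if i = j then (K : ℂ) else 0 := by
  have hK : K ≠ 0 := by omega
  have mul_conj_self : ζ * conj ζ = 1 := by
    rw [Complex.mul_conj', hζ.norm'_eq_one hK, Complex.ofReal_one, one_pow]
  set η := ζ ^ i * conj ζ ^ j with hη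
  have summand_eq (k : ℕ) : (ζ ^ k) ^ i * conj (ζ ^ k) ^ j = η ^ k := by
    rw [hη, map_pow]
    ring
  simp only [summand_eq]
  split_ifs with hij
  · simp [hη, hij, ← mul_pow, mul_conj_self]
  · have η_pow : η ^ K = 1 := by
      rw [hη, mul_pow, pow_right_comm, pow_right_comm (conj ζ), ← map_pow, hζ.pow_eq_one]
      simp
    have η_ne_one : η ≠ 1 := fun h => hij <| hζ.pow_inj hi hj <| by
      calc ζ ^ i = ζ ^ i * (ζ * conj ζ) ^ j := by rw [mul_conj_self, one_pow, mul_one]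
        _ = η * ζ ^ j := by rw [hη]; ring
        _ = ζ ^ j := by rw [h, one_mul]
    rw [geom_sum_eq η_ne_one, η_pow, sub_self, zero_div]

variable {E : Type*} [NormedAddCommGroup E] [InnerProductSpace ℂ E] {N : ℕ}

/-- The value at `w` of the `E`-valued polynomial with coefficients `h`. At the `K`-th roots of
unity, `N < K`, these values are the discrete Fourier transform of `h`. -/
noncomputable def evalVec (w : ℂ) (h : PiLp 2 fun _ : Fin (N + 1) => E) : E :=
  ∑ i : Fin (N + 1), w ^ (i : ℕ) • h i

theorem apply_evalVec (w : ℂ) (T : E →L[ℂ] E) (h : PiLp 2 fun _ : Fin (N + 1) => E) :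
    T (evalVec w h) = w • evalVec w (backwardShift T N h) + T (h 0) := by
  simp only [evalVec, map_sum, map_smul]
  rw [Fin.sum_univ_succ, Fin.sum_univ_castSucc, add_comm]
  simp [Finset.smul_sum, smul_smul, pow_succ']

theorem conj_smul_apply_evalVec {w : ℂ} (hw : ‖w‖ = 1) (T : E →L[ℂ] E)
    (h : PiLp 2 fun _ : Fin (N + 1) => E) :
    (conj w • T) (evalVec w h) = evalVec w (backwardShift T N h) + conj w • T (h 0) := by
  rw [smul_apply, apply_evalVec, smul_add, smul_smul, Complex.conj_mul', hw, Complex.ofReal_one,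
    one_pow, one_smul]

theorem sum_inner_evalVec {ζ : ℂ} {K : ℕ} (hζ : IsPrimitiveRoot ζ K) (hK : N < K)
    (u h : PiLp 2 fun _ : Fin (N + 1) => E) :
    ∑ k ∈ Finset.range K, inner ℂ (evalVec (ζ ^ k) u) (evalVec (ζ ^ k) h) = K * inner ℂ u h := by
  have sum_inner_coord (i j : Fin (N + 1)) :
      ∑ k ∈ Finset.range K, inner ℂ ((ζ ^ k) ^ (i : ℕ) • u i) ((ζ ^ k) ^ (j : ℕ) • h j) =
        if j = i then K * inner ℂ (u i) (h j) else 0 := by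
    simp only [inner_smul_left, inner_smul_right, ← mul_assoc, map_pow conj (ζ ^ _),
      ← Finset.sum_mul, sum_pow_mul_conj_pow hζ (j.is_le.trans_lt hK) (i.is_le.trans_lt hK),
      Fin.val_inj, ite_mul, zero_mul]
  simp only [evalVec, sum_inner, inner_sum]
  rw [PiLp.inner_apply, Finset.mul_sum, Finset.sum_comm]
  refine Finset.sum_congr rfl fun i _ => ?_
  rw [Finset.sum_comm]
  simp only [sum_inner_coord, Finset.sum_ite_eq, Finset.mem_univ, if_true]

theorem sum_inner_evalVec_conj_pow_smul {ζ : ℂ} {K n : ℕ} (hζ : IsPrimitiveRoot ζ K) (hn : 0 < n)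
    (hK : N + n < K) (u : PiLp 2 fun _ : Fin (N + 1) => E) (v : E) :
    ∑ k ∈ Finset.range K, inner ℂ (evalVec (ζ ^ k) u) (conj (ζ ^ k) ^ n • v) = 0 := by
  simp only [evalVec, sum_inner]
  rw [Finset.sum_comm]
  refine Finset.sum_eq_zero fun i _ => ?_
  simp only [inner_smul_left, inner_smul_right, map_pow conj (ζ ^ _), ← mul_assoc, ← pow_add,
    ← Finset.sum_mul]
  have orthogonality := sum_pow_mul_conj_pow hζ (i := 0) (j := n + i) (by omega) (by omega)
  rw [if_neg (by omega)] at orthogonality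
  simp only [pow_zero, one_mul] at orthogonality
  rw [orthogonality, zero_mul]

theorem sum_inner_pow_evalVec {ζ : ℂ} {K n : ℕ} (hζ : IsPrimitiveRoot ζ K) (hK : N + n < K)
    (T : E →L[ℂ] E) (u h : PiLp 2 fun _ : Fin (N + 1) => E) :
    ∑ k ∈ Finset.range K,
        inner ℂ (evalVec (ζ ^ k) u) (((conj (ζ ^ k) • T) ^ n) (evalVec (ζ ^ k) h)) =
      K * inner ℂ u ((backwardShift T N ^ n) h) := by
  have norm_pow_eq_one (k : ℕ) : ‖ζ ^ k‖ = 1 := by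
    rw [norm_pow, hζ.norm'_eq_one (by omega), one_pow]
  induction n generalizing h with
  | zero => simpa using sum_inner_evalVec hζ hK u h
  | succ n ih =>
    have pow_succ_evalVec (k : ℕ) : ((conj (ζ ^ k) • T) ^ (n + 1)) (evalVec (ζ ^ k) h) =
        ((conj (ζ ^ k) • T) ^ n) (evalVec (ζ ^ k) (backwardShift T N h)) +
          conj (ζ ^ k) ^ (n + 1) • (T ^ (n + 1)) (h 0) := by
      rw [pow_succ, mul_apply_eq_comp, conj_smul_apply_evalVec (norm_pow_eq_one k), map_add,
        smul_pow, smul_apply, smul_apply, map_smul, smul_smul, ← pow_succ, ← mul_apply_eq_comp,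
        ← pow_succ]
    simp only [pow_succ_evalVec, inner_add_right, Finset.sum_add_distrib]
    rw [ih (by omega), sum_inner_evalVec_conj_pow_smul hζ n.succ_pos hK, add_zero, pow_succ,
      mul_apply_eq_comp]

theorem sum_inner_aeval_evalVec {ζ : ℂ} {K : ℕ} (hζ : IsPrimitiveRoot ζ K) {p : Polynomial ℂ}
    (hK : N + p.natDegree < K) (T : E →L[ℂ] E) (u h : PiLp 2 fun _ : Fin (N + 1) => E) :
    ∑ k ∈ Finset.range K,
        inner ℂ (evalVec (ζ ^ k) u)
          (Polynomial.aeval (conj (ζ ^ k) • T) p (evalVec (ζ ^ k) h)) =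
      K * inner ℂ u (Polynomial.aeval (backwardShift T N) p h) := by
  simp only [Polynomial.aeval_eq_sum_range, sum_apply, smul_apply, inner_sum, inner_smul_right]
  rw [Finset.sum_comm, Finset.mul_sum]
  refine Finset.sum_congr rfl fun n hn => ?_
  have hn' : N + n < K := by
    have := Finset.mem_range_succ_iff.1 hn
    omega
  rw [← Finset.mul_sum, sum_inner_pow_evalVec hζ hn', mul_left_comm]

/-- The discrete Fourier transform splits `backwardShift T N`, up to high frequencies, into the
rotated operators `w̄ T`, all of which are dominated with the same constant. -/
theorem HarnackDominatedWith.map_backwardShift {c : ℝ} {T T' : E →L[ℂ] E}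
    (h : HarnackDominatedWith c T T') (N : ℕ) :
    HarnackDominatedWith c (backwardShift T N) (backwardShift T' N) := by
  intro p hp x
  obtain ⟨K, hK⟩ : ∃ K, N + p.natDegree < K := exists_gt _
  have hK_pos : (0 : ℝ) < K := by exact_mod_cast (Nat.zero_le _).trans_lt hK
  obtain ⟨ζ, hζ⟩ : ∃ ζ : ℂ, IsPrimitiveRoot ζ K := ⟨_, Complex.isPrimitiveRoot_exp K (by omega)⟩
  have norm_conj_pow_le (k : ℕ) : ‖conj (ζ ^ k)‖ ≤ 1 := by
    rw [RCLike.norm_conj, norm_pow, hζ.norm'_eq_one (by omega), one_pow]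
  have sum_re (A : E →L[ℂ] E) : ∑ k ∈ Finset.range K, (inner ℂ (evalVec (ζ ^ k) x)
      (Polynomial.aeval (conj (ζ ^ k) • A) p (evalVec (ζ ^ k) x))).re =
        K * (inner ℂ x (Polynomial.aeval (backwardShift A N) p x)).re := by
    rw [← Complex.re_sum, sum_inner_aeval_evalVec hζ hK, ← Complex.ofReal_natCast,
      Complex.re_ofReal_mul]
  have sum_le := Finset.sum_le_sum fun k (_ : k ∈ Finset.range K) =>
    h.smul (norm_conj_pow_le k) p hp (evalVec (ζ ^ k) x)
  rw [← Finset.mul_sum, sum_re, sum_re, mul_left_comm] at sum_le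
  exact le_of_mul_le_mul_left sum_le hK_pos

end Amplification

section KeyInequality

variable {E : Type*} [NormedAddCommGroup E] [InnerProductSpace ℂ E] {N : ℕ}

theorem geom_sum_backwardShift_cons_zero (T T' : E →L[ℂ] E) (g : Fin N → E) :
    (∑ n ∈ Finset.range (N + 1), backwardShift T N ^ n)
        (WithLp.toLp 2 (Fin.cons 0 g) - backwardShift T' N (WithLp.toLp 2 (Fin.cons 0 g))) 0 =
      ∑ n : Fin N, (T ^ (n : ℕ)) ((T - T') (g n)) := by
  set f : PiLp 2 fun _ : Fin (N + 1) => E := WithLp.toLp 2 (Fin.cons 0 g)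
  have f_succ (n : Fin N) : f n.succ = g n := rfl
  have f_zero : f 0 = 0 := rfl
  have pow_apply (n : Fin (N + 1)) (h : PiLp 2 fun _ : Fin (N + 1) => E) :
      (backwardShift T N ^ (n : ℕ)) h 0 = (T ^ (n : ℕ)) (h n) :=
    pow_backwardShift_apply T h (zero_add _)
  rw [← Fin.sum_univ_eq_sum_range, sum_apply, WithLp.ofLp_sum, Finset.sum_apply]
  simp only [pow_apply, PiLp.sub_apply, map_sub, Finset.sum_sub_distrib]
  rw [Fin.sum_univ_succ, Fin.sum_univ_castSucc (fun n => (T ^ (n : ℕ)) (backwardShift T' N f n))]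
  simp only [f_zero, f_succ, backwardShift_castSucc, backwardShift_last, map_zero, add_zero,
    zero_add, Fin.val_succ, Fin.val_castSucc, pow_succ, mul_apply_eq_comp, sub_apply, map_sub,
    Finset.sum_sub_distrib]

namespace HarnackDominatedWith

variable {c : ℝ} {T T' : E →L[ℂ] E}

theorem sq_norm_sum_pow_sub_le (h : HarnackDominatedWith c T T') (hT : ‖T‖ ≤ 1) (g : Fin N → E) :
    ‖∑ n : Fin N, (T ^ (n : ℕ)) ((T - T') (g n))‖ ^ 2 ≤
      c * ∑ n : Fin N, (‖g n‖ ^ 2 - ‖T' (g n)‖ ^ 2) := by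
  set f : PiLp 2 fun _ : Fin (N + 1) => E := WithLp.toLp 2 (Fin.cons 0 g) with hf
  set s := (∑ n ∈ Finset.range (N + 1), backwardShift T N ^ n)
    (f - backwardShift T' N f) with hs
  have resolvent : s - backwardShift T N s = f - backwardShift T' N f := by
    simpa [hs, pow_backwardShift_eq_zero T N.lt_succ_self] using
      congr($(mul_neg_geom_sum (backwardShift T N) (N + 1))
        (f - backwardShift T' N f))
  calc ‖∑ n : Fin N, (T ^ (n : ℕ)) ((T - T') (g n))‖ ^ 2 = ‖s 0‖ ^ 2 := by
        rw [hs, geom_sum_backwardShift_cons_zero]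
    _ ≤ ‖s‖ ^ 2 - ‖backwardShift T N s‖ ^ 2 := sq_norm_apply_zero_le hT s
    _ ≤ c * (‖f‖ ^ 2 - ‖backwardShift T' N f‖ ^ 2) :=
        (h.map_backwardShift N).sq_norm_sub_sq_norm_apply_le resolvent
          (tendsto_pow_backwardShift_apply T s) (tendsto_pow_backwardShift_apply T' f)
    _ = c * ∑ n : Fin N, (‖g n‖ ^ 2 - ‖T' (g n)‖ ^ 2) := by
        simp [sq_norm_sub_sq_norm_backwardShift, hf]

theorem sq_norm_sub_apply_le (h : HarnackDominatedWith c T T') (hT : ‖T‖ ≤ 1) (x : E) :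
    ‖(T - T') x‖ ^ 2 ≤ c * (‖x‖ ^ 2 - ‖T' x‖ ^ 2) := by
  simpa using h.sq_norm_sum_pow_sub_le hT (fun _ : Fin 1 => x)

theorem norm_right_le_one (h : HarnackDominatedWith c T T') (hc : 0 < c) (hT : ‖T‖ ≤ 1) :
    ‖T'‖ ≤ 1 := by
  refine T'.opNorm_le_bound zero_le_one fun x => ?_
  rw [one_mul, ← sq_le_sq₀ (norm_nonneg _) (norm_nonneg _), ← sub_nonneg]
  exact nonneg_of_mul_nonneg_right
    ((sq_nonneg ‖(T - T') x‖).trans (h.sq_norm_sub_apply_le hT x)) hc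

/-- With `g k = T ^ (n - k) x` all terms on the left of the key inequality coincide, so it
compares `(n + 1) ^ 2` with `n + 1`. -/
theorem sq_norm_pow_sub_apply_le (h : HarnackDominatedWith c T T') (hc : 0 ≤ c) (hT : ‖T‖ ≤ 1)
    (hcomm : Commute T T') (n : ℕ) (x : E) :
    ‖(T ^ n) (T x - T' x)‖ ^ 2 ≤ c * ‖x‖ ^ 2 * (1 / ((n : ℝ) + 1)) := by
  have term_eq (k : Fin (n + 1)) :
      (T ^ (k : ℕ)) ((T - T') ((T ^ (n - k)) x)) = (T ^ n) (T x - T' x) := by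
    have commutes : (T - T') ((T ^ (n - k)) x) = (T ^ (n - k)) (T x - T' x) :=
      congr($((((Commute.refl T).sub_left hcomm.symm).pow_right (n - k)).eq) x)
    rw [commutes, ← mul_apply_eq_comp, ← pow_add, Nat.add_sub_of_le k.is_le]
  have sum_le : ∑ k : Fin (n + 1), (‖(T ^ (n - k)) x‖ ^ 2 - ‖T' ((T ^ (n - k)) x)‖ ^ 2) ≤
      (n + 1) * ‖x‖ ^ 2 := by
    have term_le (k : Fin (n + 1)) :
        ‖(T ^ (n - k)) x‖ ^ 2 - ‖T' ((T ^ (n - k)) x)‖ ^ 2 ≤ ‖x‖ ^ 2 :=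
      (sub_le_self _ (sq_nonneg _)).trans
        (pow_le_pow_left₀ (norm_nonneg _) (norm_pow_apply_le_of_norm_le_one hT _ x) 2)
    simpa using Finset.sum_le_sum fun k (_ : k ∈ Finset.univ) => term_le k
  have key := h.sq_norm_sum_pow_sub_le hT fun k : Fin (n + 1) => (T ^ (n - k)) x
  simp only [term_eq, Finset.sum_const, Finset.card_univ, Fintype.card_fin,
    ← Nat.cast_smul_eq_nsmul ℂ, norm_smul, mul_pow, Complex.norm_natCast] at key
  rw [Nat.cast_add_one] at key
  have n_pos : (0 : ℝ) < n + 1 := by positivity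
  rw [mul_one_div, le_div_iff₀ n_pos]
  refine le_of_mul_le_mul_left ?_ n_pos
  linarith [key.trans (mul_le_mul_of_nonneg_left sum_le hc)]

end HarnackDominatedWith

end KeyInequality

section SymmetricContraction

variable {E : Type*} [NormedAddCommGroup E] [InnerProductSpace ℂ E] {S S' : E →L[ℂ] E}

theorem reApplyInnerSelf_congr (hS : S.IsSymmetric) {x y : E} (hxy : S x = S y) :
    S.reApplyInnerSelf x = S.reApplyInnerSelf y := by
  have hS' (u v : E) : inner ℂ (S u) v = inner ℂ u (S v) := hS u v
  simp only [ContinuousLinearMap.reApplyInnerSelf_apply]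
  rw [hS' x x, hxy, ← hS' x y, hxy]

theorem eq_of_reApplyInnerSelf_eq (hS : S.IsSymmetric) (hS' : S'.IsSymmetric)
    (h : ∀ x, S.reApplyInnerSelf x = S'.reApplyInnerSelf x) : S = S' := by
  refine ContinuousLinearMap.coe_injective ((ext_inner_map _ _).1 fun x => ?_)
  exact (hS.coe_reApplyInnerSelf_apply x).symm.trans
    ((congrArg _ (h x)).trans (hS'.coe_reApplyInnerSelf_apply x))

theorem apply_eq_self_of_sq_norm_le_reApplyInnerSelf (hS : ‖S‖ ≤ 1) {x : E}
    (hx : ‖x‖ ^ 2 ≤ S.reApplyInnerSelf x) : S x = x := by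
  have norm_sq_le : ‖S x‖ ^ 2 ≤ ‖x‖ ^ 2 := by
    gcongr
    exact norm_apply_le_of_norm_le_one hS x
  rw [ContinuousLinearMap.reApplyInnerSelf_apply] at hx
  have norm_sub_sq_le : ‖S x - x‖ ^ 2 ≤ 0 := by
    rw [norm_sub_sq (𝕜 := ℂ)]
    linarith
  rw [← sub_eq_zero, ← norm_eq_zero]
  exact pow_eq_zero_iff two_ne_zero |>.1 (le_antisymm norm_sub_sq_le (sq_nonneg _))

end SymmetricContraction

section AsymptoticLimit

variable {E : Type*} [NormedAddCommGroup E] [InnerProductSpace ℂ E] [CompleteSpace E]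
  {T T' : E →L[ℂ] E}

theorem norm_adjoint_pow_apply_le (hT : ‖T‖ ≤ 1) (n : ℕ) (x : E) :
    ‖(ContinuousLinearMap.adjoint T ^ n) x‖ ≤ ‖x‖ :=
  norm_pow_apply_le_of_norm_le_one ((LinearIsometryEquiv.norm_map _ T).trans_le hT) n x

theorem inner_adjoint_pow_mul_pow (T : E →L[ℂ] E) (n : ℕ) (x y : E) :
    inner ℂ ((ContinuousLinearMap.adjoint T ^ n * T ^ n) x) y =
      inner ℂ ((T ^ n) x) ((T ^ n) y) := by
  rw [← ContinuousLinearMap.star_eq_adjoint, ← star_pow, ContinuousLinearMap.star_eq_adjoint,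
    mul_apply_eq_comp, ContinuousLinearMap.adjoint_inner_left]

theorem norm_asymptoticLimit_le_one (hT : ‖T‖ ≤ 1) : ‖asymptoticLimit T‖ ≤ 1 := by
  refine ContinuousLinearMap.opNorm_le_bound _ zero_le_one fun x => ?_
  rw [one_mul]
  exact le_of_tendsto' (tendsto_asymptoticLimit T hT x).norm fun n =>
    (norm_adjoint_pow_apply_le hT n _).trans (norm_pow_apply_le_of_norm_le_one hT n x)

theorem tendsto_inner_pow_apply (hT : ‖T‖ ≤ 1) (x y : E) :
    Tendsto (fun n : ℕ => inner ℂ ((T ^ n) x) ((T ^ n) y)) atTop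
      (𝓝 (inner ℂ (asymptoticLimit T x) y)) := by
  simpa only [inner_adjoint_pow_mul_pow] using
    (tendsto_asymptoticLimit T hT x).inner (𝕜 := ℂ) (tendsto_const_nhds (x := y))

theorem isSymmetric_asymptoticLimit (hT : ‖T‖ ≤ 1) : (asymptoticLimit T).IsSymmetric := by
  intro x y
  change inner ℂ (asymptoticLimit T x) y = inner ℂ x (asymptoticLimit T y)
  rw [← inner_conj_symm x]
  refine tendsto_nhds_unique (tendsto_inner_pow_apply hT x y) ?_
  simpa only [Function.comp_def, inner_conj_symm] using
    (Complex.continuous_conj.tendsto _).comp (tendsto_inner_pow_apply hT y x)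

theorem tendsto_sq_norm_pow_apply (hT : ‖T‖ ≤ 1) (x : E) :
    Tendsto (fun n : ℕ => ‖(T ^ n) x‖ ^ 2) atTop
      (𝓝 ((asymptoticLimit T).reApplyInnerSelf x)) :=
  ((Complex.continuous_re.tendsto _).comp (tendsto_inner_pow_apply hT x x)).congr fun _ =>
    inner_self_eq_norm_sq (𝕜 := ℂ) _

theorem reApplyInnerSelf_asymptoticLimit_le (hT : ‖T‖ ≤ 1) (x : E) :
    (asymptoticLimit T).reApplyInnerSelf x ≤ ‖x‖ ^ 2 :=
  le_of_tendsto' (tendsto_sq_norm_pow_apply hT x) fun n =>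
    pow_le_pow_left₀ (norm_nonneg _) (norm_pow_apply_le_of_norm_le_one hT n x) 2

theorem mem_nullSpaceAL_iff (hT : ‖T‖ ≤ 1) {x : E} :
    x ∈ nullSpaceAL T ↔ Tendsto (fun n : ℕ => (T ^ n) x) atTop (𝓝 0) := by
  constructor
  · intro hx
    have hSx : asymptoticLimit T x = 0 := hx
    have tendsto_sq := tendsto_sq_norm_pow_apply hT x
    rw [ContinuousLinearMap.reApplyInnerSelf_apply, hSx, inner_zero_left, map_zero] at tendsto_sq
    rw [tendsto_zero_iff_norm_tendsto_zero]
    simpa using tendsto_sq.sqrt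
  · intro hx
    refine tendsto_nhds_unique (tendsto_asymptoticLimit T hT x) ?_
    exact squeeze_zero_norm (fun n => norm_adjoint_pow_apply_le hT n _)
      (tendsto_zero_iff_norm_tendsto_zero.1 hx)

theorem mem_nullSpaceAL_of_reApplyInnerSelf_nonpos (hT : ‖T‖ ≤ 1) {x : E}
    (hx : (asymptoticLimit T).reApplyInnerSelf x ≤ 0) : x ∈ nullSpaceAL T := by
  have tendsto_sq := tendsto_sq_norm_pow_apply hT x
  rw [hx.antisymm (ge_of_tendsto' tendsto_sq fun _ => sq_nonneg _)] at tendsto_sq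
  rw [mem_nullSpaceAL_iff hT, tendsto_zero_iff_norm_tendsto_zero]
  simpa using tendsto_sq.sqrt

theorem mem_nullSpaceAL_of_sq_norm_pow_le (hT : ‖T‖ ≤ 1) {x : E} {a : ℕ → ℝ}
    (hxa : ∀ n, ‖(T ^ n) x‖ ^ 2 ≤ a n) (ha : Tendsto a atTop (𝓝 0)) : x ∈ nullSpaceAL T :=
  mem_nullSpaceAL_of_reApplyInnerSelf_nonpos hT
    (le_of_tendsto_of_tendsto' (tendsto_sq_norm_pow_apply hT x) ha hxa)

theorem apply_mem_nullSpaceAL (hT : ‖T‖ ≤ 1) {A : E →L[ℂ] E} (hA : Commute A T) {x : E}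
    (hx : x ∈ nullSpaceAL T) : A x ∈ nullSpaceAL T := by
  rw [mem_nullSpaceAL_iff hT] at hx ⊢
  have tendsto_A := (A.continuous.tendsto 0).comp hx
  rw [map_zero] at tendsto_A
  exact tendsto_A.congr fun n => congr($((hA.pow_right n).eq) x)

theorem closedRangeAL_eq_orthogonal (hT : ‖T‖ ≤ 1) : closedRangeAL T = (nullSpaceAL T)ᗮ := by
  rw [ContinuousLinearMap.orthogonal_ker, (isSymmetric_asymptoticLimit hT).isSelfAdjoint.adjoint_eq]

theorem nullSpaceAL_le_orthogonal (hT : ‖T‖ ≤ 1) : nullSpaceAL T ≤ (closedRangeAL T)ᗮ := by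
  rw [closedRangeAL_eq_orthogonal hT]
  exact Submodule.le_orthogonal_orthogonal _

theorem reApplyInnerSelf_asymptoticLimit_apply (hT : ‖T‖ ≤ 1) (x : E) :
    (asymptoticLimit T).reApplyInnerSelf (T x) = (asymptoticLimit T).reApplyInnerSelf x := by
  refine tendsto_nhds_unique (tendsto_sq_norm_pow_apply hT (T x)) ?_
  simpa only [pow_succ, mul_apply_eq_comp] using
    (tendsto_add_atTop_iff_nat 1).2 (tendsto_sq_norm_pow_apply hT x)

theorem reApplyInnerSelf_asymptoticLimit_iterate (hT : ‖T‖ ≤ 1) {α : Type*} {X : α → E}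
    {V : α → α} (hV : ∀ y, T (X y) - X (V y) ∈ nullSpaceAL T) (n : ℕ) (y : α) :
    (asymptoticLimit T).reApplyInnerSelf (X (V^[n] y)) =
      (asymptoticLimit T).reApplyInnerSelf (X y) := by
  induction n with
  | zero => rfl
  | succ n ih =>
    have map_eq : asymptoticLimit T (T (X (V^[n] y))) = asymptoticLimit T (X (V (V^[n] y))) :=
      LinearMap.sub_mem_ker_iff.1 (hV _)
    rw [Function.iterate_succ_apply',
      ← reApplyInnerSelf_congr (isSymmetric_asymptoticLimit hT) map_eq,
      reApplyInnerSelf_asymptoticLimit_apply hT, ih]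

theorem reApplyInnerSelf_asymptoticLimit_le_of_sub_mem (hT : ‖T‖ ≤ 1) (hT' : ‖T'‖ ≤ 1)
    (h : ∀ x, T x - T' x ∈ nullSpaceAL T) (x : E) :
    (asymptoticLimit T).reApplyInnerSelf x ≤ (asymptoticLimit T').reApplyInnerSelf x := by
  refine ge_of_tendsto' (tendsto_sq_norm_pow_apply hT' x) fun n => ?_
  rw [FunLike.coe_pow_eq_iterate,
    ← reApplyInnerSelf_asymptoticLimit_iterate hT (X := fun y => y) h n x]
  exact reApplyInnerSelf_asymptoticLimit_le hT _

theorem asymptoticLimit_eq_of_sub_mem (hT : ‖T‖ ≤ 1) (hT' : ‖T'‖ ≤ 1)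
    (h : ∀ x, T x - T' x ∈ nullSpaceAL T) (h' : ∀ x, T x - T' x ∈ nullSpaceAL T') :
    asymptoticLimit T = asymptoticLimit T' :=
  eq_of_reApplyInnerSelf_eq (isSymmetric_asymptoticLimit hT) (isSymmetric_asymptoticLimit hT')
    fun x => le_antisymm (reApplyInnerSelf_asymptoticLimit_le_of_sub_mem hT hT' h x)
      (reApplyInnerSelf_asymptoticLimit_le_of_sub_mem hT' hT
        (fun x => neg_sub (T x) (T' x) ▸ neg_mem (h' x)) x)

namespace HarnackDominatedWith

variable {c : ℝ}

theorem sub_apply_mem_nullSpaceAL_right (h : HarnackDominatedWith c T T') (hT : ‖T‖ ≤ 1)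
    (hT' : ‖T'‖ ≤ 1) (hcomm : Commute T T') (x : E) : T x - T' x ∈ nullSpaceAL T' := by
  have tendsto_sq := tendsto_sq_norm_pow_apply hT' x
  have tendsto_decrement :=
    (tendsto_sq.sub ((tendsto_add_atTop_iff_nat 1).2 tendsto_sq)).const_mul c
  rw [sub_self, mul_zero] at tendsto_decrement
  refine mem_nullSpaceAL_of_sq_norm_pow_le hT' (fun n => ?_) tendsto_decrement
  have commutes : (T' ^ n) (T x - T' x) = (T - T') ((T' ^ n) x) :=
    congr($(((hcomm.sub_left (Commute.refl T')).pow_right n).symm.eq) x)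
  rw [commutes, pow_succ' T', mul_apply_eq_comp]
  exact h.sq_norm_sub_apply_le hT _

theorem sub_apply_mem_nullSpaceAL_left (h : HarnackDominatedWith c T T') (hc : 0 ≤ c)
    (hT : ‖T‖ ≤ 1) (hcomm : Commute T T') (x : E) : T x - T' x ∈ nullSpaceAL T :=
  mem_nullSpaceAL_of_sq_norm_pow_le hT (fun n => h.sq_norm_pow_sub_apply_le hc hT hcomm n x) <| by
    simpa using (tendsto_one_div_add_atTop_nhds_zero_nat (𝕜 := ℝ)).const_mul (c * ‖x‖ ^ 2)

theorem asymptoticLimit_eq (h : HarnackDominatedWith c T T') (hc : 0 < c) (hT : ‖T‖ ≤ 1)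
    (hcomm : Commute T T') : asymptoticLimit T = asymptoticLimit T' :=
  have hT' := h.norm_right_le_one hc hT
  asymptoticLimit_eq_of_sub_mem hT hT' (h.sub_apply_mem_nullSpaceAL_left hc.le hT hcomm)
    (h.sub_apply_mem_nullSpaceAL_right hT hT' hcomm)

end HarnackDominatedWith

section Idempotent

theorem asymptoticLimit_apply_of_mem_closedRangeAL
    (hS : asymptoticLimit T = asymptoticLimit T ^ 2) {y : E} (hy : y ∈ closedRangeAL T) :
    asymptoticLimit T y = y := by
  have hclosed : IsClosed {y | asymptoticLimit T y = y} :=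
    isClosed_eq (asymptoticLimit T).continuous continuous_id
  refine hclosed.closure_subset_iff.2 ?_ hy
  rintro _ ⟨x, rfl⟩
  exact congr($(hS.trans (pow_two _)) x).symm

theorem reApplyInnerSelf_asymptoticLimit_apply_of_mem_closedRangeAL (hT : ‖T‖ ≤ 1)
    (hS : asymptoticLimit T = asymptoticLimit T ^ 2) {y : E} (hy : y ∈ closedRangeAL T) :
    (asymptoticLimit T).reApplyInnerSelf (T y) = ‖y‖ ^ 2 := by
  rw [reApplyInnerSelf_asymptoticLimit_apply hT, ContinuousLinearMap.reApplyInnerSelf_apply,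
    asymptoticLimit_apply_of_mem_closedRangeAL hS hy]
  exact inner_self_eq_norm_sq (𝕜 := ℂ) y

theorem norm_apply_of_mem_closedRangeAL (hT : ‖T‖ ≤ 1)
    (hS : asymptoticLimit T = asymptoticLimit T ^ 2) {y : E} (hy : y ∈ closedRangeAL T) :
    ‖T y‖ = ‖y‖ := by
  refine le_antisymm (norm_apply_le_of_norm_le_one hT y) (le_of_sq_le_sq ?_ (norm_nonneg _))
  rw [← reApplyInnerSelf_asymptoticLimit_apply_of_mem_closedRangeAL hT hS hy]
  exact reApplyInnerSelf_asymptoticLimit_le hT _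

theorem apply_mem_closedRangeAL (hT : ‖T‖ ≤ 1) (hS : asymptoticLimit T = asymptoticLimit T ^ 2)
    {y : E} (hy : y ∈ closedRangeAL T) : T y ∈ closedRangeAL T := by
  refine Submodule.le_topologicalClosure _ ⟨T y, ?_⟩
  refine apply_eq_self_of_sq_norm_le_reApplyInnerSelf (norm_asymptoticLimit_le_one hT) ?_
  rw [norm_apply_of_mem_closedRangeAL hT hS hy,
    reApplyInnerSelf_asymptoticLimit_apply_of_mem_closedRangeAL hT hS hy]

end Idempotent

end AsymptoticLimit

section DirectSum

variable {E : Type*} [NormedAddCommGroup E] [InnerProductSpace ℂ E] {T T' : E →L[ℂ] E}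
  {M L : Submodule ℂ E} {Q Q' : M →L[ℂ] M} {W W' : L →L[ℂ] L} {c : ℝ}

theorem inner_add_of_isOrtho {u v : M} {x y : L} (hML : M ⟂ L) :
    inner ℂ (u + x : E) (v + y : E) = inner ℂ u v + inner ℂ x y := by
  rw [inner_add_left, inner_add_right, inner_add_right, hML.inner_eq u.2 y.2,
    hML.symm.inner_eq x.2 v.2, add_zero, zero_add, Submodule.coe_inner, Submodule.coe_inner]

theorem inner_aeval_add_of_isOrtho (hML : M ⟂ L) (hQ : ∀ x, (Q x : E) = T x)
    (hW : ∀ y, (W y : E) = T y) (p : Polynomial ℂ) (x : M) (y : L) :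
    inner ℂ (x + y : E) (Polynomial.aeval T p (x + y : E)) =
      inner ℂ x (Polynomial.aeval Q p x) + inner ℂ y (Polynomial.aeval W p y) := by
  have aeval_x : (Polynomial.aeval Q p x : M) = Polynomial.aeval T p (x : E) :=
    map_aeval_apply_of_semiconj (X := M.subtype) hQ p x
  have aeval_y : (Polynomial.aeval W p y : L) = Polynomial.aeval T p (y : E) :=
    map_aeval_apply_of_semiconj (X := L.subtype) hW p y
  rw [map_add, ← aeval_x, ← aeval_y, inner_add_of_isOrtho hML]

namespace HarnackDominatedWith

theorem of_isOrtho (hML : M ⟂ L) (hsup : M ⊔ L = ⊤) (hQ : ∀ x, (Q x : E) = T x)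
    (hQ' : ∀ x, (Q' x : E) = T' x) (hW : ∀ y, (W y : E) = T y) (hW' : ∀ y, (W' y : E) = T' y)
    (hQQ' : HarnackDominatedWith c Q Q') (hWW' : HarnackDominatedWith c W W') :
    HarnackDominatedWith c T T' := by
  intro p hp z
  obtain ⟨x, hx, y, hy, rfl⟩ := Submodule.mem_sup.1 (hsup ▸ Submodule.mem_top : z ∈ M ⊔ L)
  lift x to M using hx
  lift y to L using hy
  rw [inner_aeval_add_of_isOrtho hML hQ hW, inner_aeval_add_of_isOrtho hML hQ' hW',
    Complex.add_re, Complex.add_re, mul_add]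
  exact add_le_add (hQQ' p hp x) (hWW' p hp y)

theorem self_of_one_le {c' : ℝ} (h : HarnackDominatedWith c T T) (hc : 1 < c) (hc' : 1 ≤ c') :
    HarnackDominatedWith c' T T := by
  intro p hp x
  have nonneg : 0 ≤ (c - 1) * (inner ℂ x (Polynomial.aeval T p x)).re := by
    linarith [h p hp x]
  exact le_mul_of_one_le_left (nonneg_of_mul_nonneg_right nonneg (sub_pos.2 hc)) hc'

/-- The test polynomials `1 + w z` with `‖w‖ ≤ 1` are enough. -/
theorem eq_of_one (h : HarnackDominatedWith 1 T T') : T = T' := by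
  have re_mul_le (x : E) {w : ℂ} (hw : ‖w‖ ≤ 1) :
      (w * inner ℂ x (T x)).re ≤ (w * inner ℂ x (T' x)).re := by
    have key := h (1 + Polynomial.C w * Polynomial.X) (fun z hz => by
      have norm_mul_le : ‖w * z‖ ≤ 1 := by
        rw [norm_mul]
        exact mul_le_one₀ hw (norm_nonneg _) hz
      simpa using neg_le_iff_add_nonneg'.1
        (abs_le.1 ((Complex.abs_re_le_norm (w * z)).trans norm_mul_le)).1) x
    simpa [Algebra.algebraMap_eq_smul_one, inner_add_right, inner_smul_right] using key
  refine ContinuousLinearMap.coe_injective ((ext_inner_map _ _).1 fun x => ?_)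
  suffices inner ℂ x (T x - T' x) = 0 by
    rw [← sub_eq_zero, ← inner_sub_left, ← inner_conj_symm]
    exact (congrArg _ this).trans (map_zero _)
  obtain ⟨w, hw, norm_eq⟩ := Complex.exists_norm_eq_mul_self (inner ℂ x (T x - T' x))
  rw [← norm_le_zero_iff, ← Complex.ofReal_re ‖_‖, norm_eq, inner_sub_right, mul_sub,
    Complex.sub_re, sub_nonpos]
  exact re_mul_le x hw.le

end HarnackDominatedWith

/-- Domination of the common block `W` by itself with a constant `c > 1` means `Re p(W) ≥ 0`, which
is all that is needed of `W`; this says nothing for `c = 1`, but then `T = T'`. -/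
theorem HarnackDominated.symm_of_isOrtho [CompleteSpace E] [CompleteSpace M]
    (h : HarnackDominated T T') (hML : M ⟂ L) (hsup : M ⊔ L = ⊤) (hQ : ∀ x, (Q x : E) = T x)
    (hQ' : ∀ x, (Q' x : E) = T' x) (hW : ∀ y, (W y : E) = T y) (hW' : ∀ y, (W y : E) = T' y)
    (hQ'Q : HarnackDominated Q' Q) : HarnackDominated T' T := by
  obtain ⟨c, hc, hTT'⟩ := harnackDominated_iff.1 h
  rcases hc.eq_or_lt with rfl | hc
  · obtain rfl := hTT'.eq_of_one
    exact h
  · obtain ⟨c', hc', hQ'Q⟩ := harnackDominated_iff.1 hQ'Q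
    have hWW : HarnackDominatedWith c W W := hTT'.of_semiconj L.subtypeₗᵢ hW hW'
    exact harnackDominated_iff.2 ⟨c', hc',
      .of_isOrtho hML hsup hQ' hQ hW' hW hQ'Q (hWW.self_of_one_le hc hc')⟩

theorem HarnackDominated.restrict [CompleteSpace E] [CompleteSpace M] (h : HarnackDominated T T')
    (hQ : ∀ x, (Q x : E) = T x) (hQ' : ∀ x, (Q' x : E) = T' x) : HarnackDominated Q Q' := by
  obtain ⟨c, hc, hTT'⟩ := harnackDominated_iff.1 h
  exact harnackDominated_iff.2 ⟨c, hc, hTT'.of_semiconj M.subtypeₗᵢ hQ hQ'⟩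

end DirectSum

section CompressionBlock

variable {E : Type*} [NormedAddCommGroup E] [InnerProductSpace ℂ E] {T T' : E →L[ℂ] E}
  {M L : Submodule ℂ E} [M.HasOrthogonalProjection]

/-- The block `P_M T|_L` of `T`, an entry of its matrix with respect to an orthogonal decomposition
of the space in which `M` and `L` are summands. -/
noncomputable def compressionBlock (T : E →L[ℂ] E) (M L : Submodule ℂ E)
    [M.HasOrthogonalProjection] : L →L[ℂ] M :=
  M.orthogonalProjectionOnto ∘L T ∘L L.subtypeL

theorem coe_compressionBlock_apply (y : L) :
    (compressionBlock T M L y : E) = M.starProjection (T y) := rfl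

theorem compressionBlock_eq_of_sub_mem_orthogonal (h : ∀ x, T x - T' x ∈ Mᗮ) :
    compressionBlock T M L = compressionBlock T' M L := by
  ext y
  rw [coe_compressionBlock_apply, coe_compressionBlock_apply, ← sub_eq_zero, ← map_sub]
  exact M.starProjection_apply_eq_zero_iff.2 (h y)

theorem isCanonicalTriangulation_compressionBlock [CompleteSpace E] [L.HasOrthogonalProjection]
    (hT : ‖T‖ ≤ 1) (hM : M = nullSpaceAL T) (hL : L = closedRangeAL T) :
    IsCanonicalTriangulation T (compressionBlock T M M) (compressionBlock T M L)
      (compressionBlock T L L) := by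
  have hLM : L = Mᗮ := by rw [hL, closedRangeAL_eq_orthogonal hT, hM]
  refine ⟨hM, hL, hLM ▸ M.isOrtho_orthogonal_right, hLM ▸ M.isCompl_orthogonal, fun x y => ?_⟩
  have hTx : T x ∈ M := hM.ge (apply_mem_nullSpaceAL hT (Commute.refl T) (hM.le x.2))
  simp only [map_add, Submodule.coe_add, coe_compressionBlock_apply,
    Submodule.starProjection_eq_self_iff.2 hTx, add_assoc]
  subst hLM
  rw [M.starProjection_add_starProjection_orthogonal]

end CompressionBlock

namespace IsCanonicalTriangulation

variable {E : Type*} [NormedAddCommGroup E] [InnerProductSpace ℂ E] [CompleteSpace E]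
  {T T' : E →L[ℂ] E} {M L : Submodule ℂ E} {Q Q' : M →L[ℂ] M} {R R' : L →L[ℂ] M} {W : L →L[ℂ] L}

theorem coe_left_apply (h : IsCanonicalTriangulation T Q R W) (x : M) : (Q x : E) = T x := by
  simpa using (h.apply_add x 0).symm

theorem apply_right (h : IsCanonicalTriangulation T Q R W) (y : L) :
    T y = (R y : E) + (W y : E) := by
  simpa using h.apply_add 0 y

theorem isClassC0 (h : IsCanonicalTriangulation T Q R W) (hT : ‖T‖ ≤ 1) : IsClassC0 Q := by
  refine ⟨Q.opNorm_le_bound zero_le_one fun x => ?_, fun x => ?_⟩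
  · rw [one_mul, Submodule.coe_norm, h.coe_left_apply]
    exact norm_apply_le_of_norm_le_one hT _
  · rw [tendsto_subtype_rng]
    exact ((mem_nullSpaceAL_iff hT).1 (h.null_eq.le x.2)).congr fun n =>
      (map_pow_apply_of_semiconj (X := M.subtype) h.coe_left_apply n x).symm

theorem left_mul_comm (h : IsCanonicalTriangulation T Q R W)
    (h' : IsCanonicalTriangulation T' Q' R' W) (hcomm : Commute T T') : Q * Q' = Q' * Q := by
  ext x
  simp only [mul_apply_eq_comp, h.coe_left_apply, h'.coe_left_apply]
  exact congr($hcomm.eq x)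

theorem left_comp_right_sub (h : IsCanonicalTriangulation T Q R W)
    (h' : IsCanonicalTriangulation T' Q' R' W) (hcomm : Commute T T') :
    Q ∘L R' - Q' ∘L R = (R' - R) ∘L W := by
  ext y
  have apply_comm : T (T' y) = T' (T y) := congr($hcomm.eq y)
  rw [h.apply_right, h'.apply_right, h.apply_add, h'.apply_add] at apply_comm
  have upper_eq : Q (R' y) + R (W y) = Q' (R y) + R' (W y) :=
    Subtype.ext (add_right_cancel apply_comm)
  refine congrArg Subtype.val (?_ : Q (R' y) - Q' (R y) = R' (W y) - R (W y))
  rw [sub_eq_sub_iff_add_eq_add, upper_eq, add_comm]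

theorem norm_lower_apply_le (h : IsCanonicalTriangulation T Q R W) (y : L) : ‖W y‖ ≤ ‖T y‖ := by
  have pythagoras := norm_add_sq_eq_norm_sq_add_norm_sq_of_inner_eq_zero (𝕜 := ℂ) _ _
    (h.ortho.inner_eq (R y).2 (W y).2)
  rw [← h.apply_right] at pythagoras
  exact nonneg_le_nonneg_of_sq_le_sq (norm_nonneg _)
    (pythagoras ▸ le_add_of_nonneg_left (mul_self_nonneg _))

theorem apply_sub_lower_mem (h : IsCanonicalTriangulation T Q R W) (y : L) :
    T y - W y ∈ nullSpaceAL T := by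
  rw [h.apply_right, add_sub_cancel_right]
  exact h.null_eq ▸ (R y).2

theorem isClassC1 (h : IsCanonicalTriangulation T Q R W) (hT : ‖T‖ ≤ 1) : IsClassC1 W := by
  refine ⟨W.opNorm_le_bound zero_le_one fun y => ?_, fun y hy hlim => hy ?_⟩
  · rw [one_mul]
    exact (h.norm_lower_apply_le y).trans (norm_apply_le_of_norm_le_one hT _)
  have form_le (n : ℕ) : (asymptoticLimit T).reApplyInnerSelf y ≤ ‖(W ^ n) y‖ ^ 2 := by
    rw [← reApplyInnerSelf_asymptoticLimit_iterate hT h.apply_sub_lower_mem n y,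
      ← FunLike.coe_pow_eq_iterate]
    exact reApplyInnerSelf_asymptoticLimit_le hT _
  have tendsto_sq : Tendsto (fun n : ℕ => ‖(W ^ n) y‖ ^ 2) atTop (𝓝 0) := by
    simpa only [norm_zero, zero_pow two_ne_zero] using hlim.norm.pow 2
  have y_mem : (y : E) ∈ M := h.null_eq ▸
    mem_nullSpaceAL_of_reApplyInnerSelf_nonpos hT (ge_of_tendsto' tendsto_sq form_le)
  exact Subtype.ext (Submodule.disjoint_def.1 h.compl.disjoint _ y_mem y.2)

theorem right_eq_zero (h : IsCanonicalTriangulation T Q R W) (hT : ‖T‖ ≤ 1)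
    (hS : asymptoticLimit T = asymptoticLimit T ^ 2) : R = 0 := by
  ext y
  have Ty_mem : T y ∈ L := h.range_eq.ge (apply_mem_closedRangeAL hT hS (h.range_eq.le y.2))
  have Ry_mem : (R y : E) ∈ L := by
    rw [eq_sub_of_add_eq (h.apply_right y).symm]
    exact sub_mem Ty_mem (W y).2
  exact Submodule.disjoint_def.1 h.compl.disjoint _ (R y).2 Ry_mem

theorem coe_lower_apply (h : IsCanonicalTriangulation T Q R W) (hT : ‖T‖ ≤ 1)
    (hS : asymptoticLimit T = asymptoticLimit T ^ 2) (y : L) : (W y : E) = T y := by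
  simp [h.apply_right, h.right_eq_zero hT hS]

theorem isometry (h : IsCanonicalTriangulation T Q R W) (hT : ‖T‖ ≤ 1)
    (hS : asymptoticLimit T = asymptoticLimit T ^ 2) : Isometry W := by
  refine AddMonoidHomClass.isometry_of_norm W fun y => ?_
  rw [Submodule.coe_norm, h.coe_lower_apply hT hS]
  exact norm_apply_of_mem_closedRangeAL hT hS (h.range_eq ▸ y.2)

theorem harnackEquivalent_iff [CompleteSpace M] (h : IsCanonicalTriangulation T Q R W)
    (h' : IsCanonicalTriangulation T' Q' R' W) (hT : ‖T‖ ≤ 1) (hT' : ‖T'‖ ≤ 1)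
    (hS : asymptoticLimit T = asymptoticLimit T ^ 2)
    (hS' : asymptoticLimit T' = asymptoticLimit T' ^ 2) (hdom : HarnackDominated T T') :
    HarnackEquivalent T T' ↔ HarnackDominated Q' Q :=
  ⟨fun hequiv => hequiv.2.restrict h'.coe_left_apply h.coe_left_apply,
    fun hQ'Q => ⟨hdom, hdom.symm_of_isOrtho h.ortho h.compl.sup_eq_top h.coe_left_apply
      h'.coe_left_apply (h.coe_lower_apply hT hS) (h'.coe_lower_apply hT' hS') hQ'Q⟩⟩

end IsCanonicalTriangulation

theorem mainTheorem3_general {H : Type*} [NormedAddCommGroup H] [InnerProductSpace ℂ H]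
    [CompleteSpace H] {T T' : H →L[ℂ] H} (hT : ‖T‖ ≤ 1) (hcomm : T * T' = T' * T)
    (hdom : HarnackDominated T T') :
    asymptoticLimit T = asymptoticLimit T' ∧
    ∃ (Q Q' : nullSpaceAL T →L[ℂ] nullSpaceAL T)
      (R R' : closedRangeAL T →L[ℂ] nullSpaceAL T)
      (W : closedRangeAL T →L[ℂ] closedRangeAL T),
      IsCanonicalTriangulation T Q R W ∧ IsCanonicalTriangulation T' Q' R' W ∧
      IsClassC0 Q ∧ IsClassC0 Q' ∧ Q * Q' = Q' * Q ∧ HarnackDominated Q Q' ∧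
      IsClassC1 W ∧ Q ∘L R' - Q' ∘L R = (R' - R) ∘L W ∧
      (asymptoticLimit T = asymptoticLimit T ^ 2 →
        Isometry W ∧ R = 0 ∧ R' = 0 ∧ (HarnackEquivalent T T' ↔ HarnackDominated Q' Q)) := by
  obtain ⟨c, hc, hTT'⟩ := harnackDominated_iff.1 hdom
  have hc_pos : 0 < c := zero_lt_one.trans_le hc
  have hT' : ‖T'‖ ≤ 1 := hTT'.norm_right_le_one hc_pos hT
  have hS : asymptoticLimit T = asymptoticLimit T' := hTT'.asymptoticLimit_eq hc_pos hT hcomm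
  have : CompleteSpace (closedRangeAL T) :=
    (Submodule.isClosed_topologicalClosure _).completeSpace_coe
  have h := isCanonicalTriangulation_compressionBlock (M := nullSpaceAL T)
    (L := closedRangeAL T) hT rfl rfl
  have h' := isCanonicalTriangulation_compressionBlock (M := nullSpaceAL T)
    (L := closedRangeAL T) hT' congr(($hS).ker) congr(($hS).range.topologicalClosure)
  have hW : compressionBlock T (closedRangeAL T) (closedRangeAL T) =
      compressionBlock T' (closedRangeAL T) (closedRangeAL T) :=
    compressionBlock_eq_of_sub_mem_orthogonal fun x => nullSpaceAL_le_orthogonal hT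
      (hTT'.sub_apply_mem_nullSpaceAL_left hc_pos.le hT hcomm x)
  rw [← hW] at h'
  exact ⟨hS, _, _, _, _, _, h, h', h.isClassC0 hT, h'.isClassC0 hT', h.left_mul_comm h' hcomm,
    hdom.restrict h.coe_left_apply h'.coe_left_apply, h.isClassC1 hT,
    h.left_comp_right_sub h' hcomm, fun hidem => ⟨h.isometry hT hidem, h.right_eq_zero hT hidem,
      h'.right_eq_zero hT' (hS ▸ hidem),
      h.harnackEquivalent_iff h' hT hT' hidem (hS ▸ hidem) hdom⟩⟩

theorem mainTheorem3 {H : Type*} [NormedAddCommGroup H] [InnerProductSpace ℂ H] [CompleteSpace H]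
    (T T' : H →L[ℂ] H) (hT : ‖T‖ ≤ 1) (hT' : ‖T'‖ ≤ 1) (hcomm : T * T' = T' * T)
    (hdom : HarnackDominated T T') :
    nullSpaceAL T = nullSpaceAL T' ∧ closedRangeAL T = closedRangeAL T' ∧
    ∃ (Q Q' : nullSpaceAL T →L[ℂ] nullSpaceAL T)
      (R R' : closedRangeAL T →L[ℂ] nullSpaceAL T)
      (W : closedRangeAL T →L[ℂ] closedRangeAL T),
      IsCanonicalTriangulation T Q R W ∧ IsCanonicalTriangulation T' Q' R' W ∧
      IsClassC0 Q ∧ IsClassC0 Q' ∧ Q * Q' = Q' * Q ∧ HarnackDominated Q Q' ∧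
      IsClassC1 W ∧ Q ∘L R' - Q' ∘L R = (R' - R) ∘L W ∧
      (asymptoticLimit T = asymptoticLimit T ^ 2 ↔
        asymptoticLimit T' = asymptoticLimit T' ^ 2) ∧
      (asymptoticLimit T = asymptoticLimit T ^ 2 →
        asymptoticLimit T = asymptoticLimit T' ∧ Isometry W ∧ R = 0 ∧ R' = 0 ∧
        (HarnackEquivalent T T' ↔ HarnackDominated Q' Q)) := by
  obtain ⟨hS, Q, Q', R, R', W, h, h', hQ, hQ', hQQ', hdomQ, hW, hR, hidem⟩ :=
    mainTheorem3_general hT hcomm hdom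
  exact ⟨congr(($hS).ker), congr(($hS).range.topologicalClosure), Q, Q', R, R', W, h, h', hQ,
    hQ', hQQ', hdomQ, hW, hR, by rw [hS], fun hidemT => ⟨hS, hidem hidemT⟩⟩
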